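/- All graphs are finite, simple and undirected. **Zero forcing.** Given a graph $G$ and a set $S\subseteq V(G)$ of initially blue vertices (all others white), a blue vertex with exactly one white neighbour forces that neighbour to become blue; this rule is applied until no further force is possible. $S$ is a zero forcing set if all vertices end up blue, and $z(G;k)$ is the number of zero forcing sets of size $k$. A graph $G$ on $n$ vertices is *path-extremal* if $z(G;k)\le z(P_n;k)$ for all $0\le k\le n$, where $P_n$ is the path on $n$ vertices. **Splits.** A split of a connected graph $G$ is a partition $(A,B)$ of $V(G)$ with $|A|,|B|\ge 2$ for which there are nonempty sets $A_1\subseteq A$, $B_1\subseteq B$ such that, for all $a\in A$ and $b\in B$, $ab\in E(G)$ if and only if $a\in A_1$ and $b\in B_1$. A connected graph is *split-prime* if it has no split and is neither a clique nor a star. **Canonical split decomposition.** A graph-labelled tree on $V$ is a finite tree whose nodes (bags) $B$ carry label graphs; the vertices of the label graph of $B$ are one marker vertex for each tree edge at $B$, together with the ordinary vertices of $B$, where each element of $V$ is an ordinary vertex of exactly one bag. It represents the graph $G$ on $V$ in which $u\in B_0$ and $v\in B_t$ are adjacent if and only if, along the tree path $B_0,\dots,B_t$ between their bags, $u$ is adjacent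 in the label of $B_0$ to the marker towards $B_1$, the two markers of $B_i$ corresponding to the edges $B_{i-1}B_i$ and $B_iB_{i+1}$ are adjacent in the label of $B_i$ for $0<i<t$, and the marker of $B_t$ towards $B_{t-1}$ is adjacent to $v$ in the label of $B_t$ (for $t=0$: $u$ and $v$ are adjacent in the label of $B_0$). It is reduced if every label graph has at least three vertices and is a clique, a star or split-prime (the latter are the prime bags), no tree edge joins two clique bags, and no tree edge joins two star bags so that its marker is a leaf of one star and the center of the other. The canonical split decomposition of a connected graph $G$ (on at least three vertices) is the reduced graph-labelled tree representing $G$, which is unique up to isomorphism. For a split-prime graph $H$, let $\mathcal C(H)$ be the class of connected graphs whose canonical split decomposition has exactly one prime bag, with the label graph of that bag isomorphic to $H$. **Theorem.** Let $H$ be a split-prime graph, and suppose that every induced subgraph of $H$ is path-extremal. Then every graph in $\mathcal C(H)$ is path-extremal. -/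

import Mathlib

universe u v

namespace ZeroForcing

/-- `Forced G S v`: the vertex `v` is blue at the end of the zero forcing process started from the
blue set `S`: either `v ∈ S`, or `v` is the only neighbour of some blue vertex `u` that is not
otherwise blue. -/
inductive Forced {V : Type u} (G : SimpleGraph V) (S : Set V) : V → Prop
  | init {w : V} (hw : w ∈ S) : Forced G S w
  | force {x w : V} (hx : Forced G S x) (hxw : G.Adj x w)
      (hrest : ∀ y : V, G.Adj x y → y ≠ w → Forced G S y) : Forced G S w

/-- The zero forcing closure `cl_G(S)`. -/
def closure {V : Type u} (G : SimpleGraph V) (S : Set V) : Set V := {w | Forced G S w}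

/-- `S` is a zero forcing set of `G`. -/
def IsZeroForcingSet {V : Type u} (G : SimpleGraph V) (S : Set V) : Prop :=
  closure G S = Set.univ

/-- `z(G;k)`: the number of zero forcing sets of `G` of size `k` (for a finite graph `G`). -/
noncomputable def z {V : Type u} (G : SimpleGraph V) (k : ℕ) : ℕ :=
  Set.ncard {S : Finset V | S.card = k ∧ IsZeroForcingSet G (S : Set V)}

/-- A finite graph `G` on `n` vertices is path-extremal if `z(G;k) ≤ z(P_n;k)` for all
`0 ≤ k ≤ n`. -/
def PathExtremal {V : Type u} (G : SimpleGraph V) : Prop :=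
  ∀ k : ℕ, k ≤ Nat.card V → z G k ≤ z (SimpleGraph.pathGraph (Nat.card V)) k

end ZeroForcing

namespace SplitDecomposition

/-- The partition `(A, B)` of the vertex set is a split of the (finite) graph `G`. -/
def IsSplit {V : Type u} (G : SimpleGraph V) (A B : Set V) : Prop :=
  IsCompl A B ∧ 2 ≤ A.ncard ∧ 2 ≤ B.ncard ∧
    ∃ A₁ B₁ : Set V, A₁ ⊆ A ∧ B₁ ⊆ B ∧ A₁.Nonempty ∧ B₁.Nonempty ∧
      ∀ a ∈ A, ∀ b ∈ B, G.Adj a b ↔ a ∈ A₁ ∧ b ∈ B₁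

/-- `G` is a clique (a complete graph). -/
def IsCliqueGraph {V : Type u} (G : SimpleGraph V) : Prop :=
  G = ⊤

/-- `G` is a star with center `c`. -/
def IsStarWithCenter {V : Type u} (G : SimpleGraph V) (c : V) : Prop :=
  G = SimpleGraph.starGraph c

/-- `G` is a star. -/
def IsStar {V : Type u} (G : SimpleGraph V) : Prop := ∃ c : V, IsStarWithCenter G c

/-- `G` is split-prime: connected, without a split, and neither a clique nor a star. -/
def SplitPrime {V : Type u} (G : SimpleGraph V) : Prop :=
  G.Connected ∧ (¬ ∃ A B : Set V, IsSplit G A B) ∧ ¬ IsCliqueGraph G ∧ ¬ IsStar G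

/-- A graph-labelled tree with set of ordinary vertices `V`. Its nodes are the bags; the ordinary
vertex `w` lies in the bag `home w`. The label graph of a bag `b` has as its vertices the ordinary
vertices lying in `b` together with one marker vertex for every tree edge at `b` (the marker is
named by the neighbouring bag to which the edge leads). -/
structure GraphLabelledTree (V : Type u) where
  /-- the bags -/
  Bag : Type
  [finite : Finite Bag]
  /-- the decomposition tree -/
  tree : SimpleGraph Bag
  isTree : tree.IsTree
  /-- the bag in which an ordinary vertex lies -/
  home : V → Bag
  /-- the label graph of a bag -/
  label : (b : Bag) → SimpleGraph ({w : V // home w = b} ⊕ {b' : Bag // tree.Adj b b'})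

namespace GraphLabelledTree

variable {V : Type u}

/-- The vertices of the label graph of the bag `b`. -/
abbrev LabelVertex (T : GraphLabelledTree V) (b : T.Bag) : Type u :=
  {w : V // T.home w = b} ⊕ {b' : T.Bag // T.tree.Adj b b'}

/-- The ordinary vertex `w`, as a vertex of the label graph of its bag. -/
def ordinary (T : GraphLabelledTree V) (w : V) : T.LabelVertex (T.home w) :=
  Sum.inl ⟨w, rfl⟩

/-- The marker vertex of the bag `b` corresponding to the tree edge `bb'`. -/
def marker (T : GraphLabelledTree V) {b b' : T.Bag} (h : T.tree.Adj b b') : T.LabelVertex b :=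
  Sum.inr ⟨b', h⟩

/-- Accessibility along a walk `B₀, …, B_t` of the tree from a label vertex `x` of `B₀` to a label
vertex `y` of `B_t`. For `t = 0` it says that `x` and `y` are adjacent in the label of `B₀`;
otherwise, that `x` is adjacent to the marker of `B₀` towards `B₁`, the two markers of `Bᵢ` on the
walk are adjacent in the label of `Bᵢ` for `0 < i < t`, and the marker of `B_t` towards `B_{t-1}`
is adjacent to `y`. -/
def AccessibleAlong (T : GraphLabelledTree V) : {b c : T.Bag} → T.tree.Walk b c →
    T.LabelVertex b → T.LabelVertex c → Prop
  | b, _, .nil, x, y => (T.label b).Adj x y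
  | b, _, .cons h p, x, y =>
      (T.label b).Adj x (T.marker h) ∧ T.AccessibleAlong p (T.marker h.symm) y

/-- `T` represents the graph `G`: two vertices of `G` are adjacent if and only if they are
accessible from each other along the path of the tree between their bags. -/
def Represents (T : GraphLabelledTree V) (G : SimpleGraph V) : Prop :=
  ∀ x y : V, G.Adj x y ↔
    ∃ p : T.tree.Walk (T.home x) (T.home y),
      p.IsPath ∧ T.AccessibleAlong p (T.ordinary x) (T.ordinary y)

/-- `T` is reduced: every label graph has at least three vertices and is a clique, a star or
split-prime; no tree edge joins two clique bags; and no tree edge joins two star bags so that its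
marker is a leaf of one star and the center of the other. -/
structure IsReduced (T : GraphLabelledTree V) : Prop where
  three_le : ∀ b : T.Bag, 3 ≤ Nat.card (T.LabelVertex b)
  label_type : ∀ b : T.Bag,
    IsCliqueGraph (T.label b) ∨ IsStar (T.label b) ∨ SplitPrime (T.label b)
  no_clique_clique : ∀ b b' : T.Bag, T.tree.Adj b b' →
    ¬ (IsCliqueGraph (T.label b) ∧ IsCliqueGraph (T.label b'))
  no_leaf_center : ∀ (b b' : T.Bag) (h : T.tree.Adj b b'),
    ¬ ((∃ c : T.LabelVertex b, IsStarWithCenter (T.label b) c ∧ T.marker h ≠ c) ∧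
      IsStarWithCenter (T.label b') (T.marker h.symm))

/-- `T` is the canonical split decomposition of the connected graph `G`: the reduced
graph-labelled tree representing `G` (it is unique up to isomorphism). -/
def IsCanonicalSplitDecomposition (T : GraphLabelledTree V) (G : SimpleGraph V) : Prop :=
  T.Represents G ∧ T.IsReduced

end GraphLabelledTree

/-- The class `𝒞(H)`: `G` is connected and its canonical split decomposition has exactly one prime
bag, the label graph of which is isomorphic to `H`. -/
def InClassC {V : Type u} {W : Type v} (H : SimpleGraph W) (G : SimpleGraph V) : Prop :=
  G.Connected ∧ ∃ T : GraphLabelledTree V, T.IsCanonicalSplitDecomposition G ∧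
    ∃ b : T.Bag, SplitPrime (T.label b) ∧ (∀ b' : T.Bag, SplitPrime (T.label b') → b' = b) ∧
      Nonempty (T.label b ≃g H)

end SplitDecomposition

/-! A set fails to be zero forcing exactly when it misses a fort, so path-extremality says that `G`
has at least as many failing `k`-sets as the path on equally many vertices. This is proved for every
induced subgraph `G[U]`, by strong induction on `U` (`extremalOn`).

Seen from the prime bag `r`, each vertex is represented by a vertex of the label of `r` (`proj`). If
these images are distinct on `U`, then either some vertex is not accessible from `r` and is isolated
in `G[U]`, or `G[U]` embeds as an induced subgraph of `H` and the hypothesis on `H` applies.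
Otherwise two vertices of `U` lie beyond the same marker. A bag farthest from `r` with at least two
vertices of `U` beyond it is a clique or a star, and each of these vertices is alone in its image
there (`exists_deepest_bag`). Hence `G[U]` has a pair of twins, an isolated vertex or a pendant
vertex (`extremalOn_of_private`).

Twins or an isolated vertex give a fort of size at most two. The sets avoiding it already number at
least `(n-2).choose k`, a bound for the path because its failing sets avoid both ends. A pendant
vertex `p` at `c` gives a recurrence through `U \ {p}` and `U \ {p, c}` (`card_failing_pendant`).
The path count obeys the opposite inequality (`pathFail_le_add`), so induction closes the case. -/

namespace ZeroForcing

/-! ### Forts and failing sets -/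

variable {V : Type u} {W : Type v}

/-- `F` is a fort of the subgraph of `G` induced on `U`: a nonempty subset of `U` such that no
vertex of `U` outside `F` has exactly one neighbour in `F`. -/
def IsFort (G : SimpleGraph V) (U F : Finset V) : Prop :=
  F.Nonempty ∧ F ⊆ U ∧ ∀ x ∈ U, x ∉ F → ∀ w ∈ F, G.Adj x w → ∃ y ∈ F, y ≠ w ∧ G.Adj x y

/-- The set `S` misses some fort of the subgraph induced on `U`, that is, it is not zero forcing
there. -/
def Fails (G : SimpleGraph V) (U S : Finset V) : Prop :=
  ∃ F, IsFort G U F ∧ Disjoint S F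

open Classical in
/-- The failing subsets of `U` of size `k`. -/
noncomputable def failing (G : SimpleGraph V) (U : Finset V) (k : ℕ) : Finset (Finset V) :=
  {S ∈ U.powersetCard k | Fails G U S}

theorem mem_failing {G : SimpleGraph V} {U S : Finset V} {k : ℕ} :
    S ∈ failing G U k ↔ (S ⊆ U ∧ S.card = k) ∧ Fails G U S := by
  simp [failing, Finset.mem_powersetCard]

/-- The vertices left white at the end form a fort. Conversely, no vertex of a fort disjoint from
`S` can be the first of that fort to be forced. -/
theorem not_isZeroForcingSet_iff [Fintype V] (G : SimpleGraph V) (S : Finset V) :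
    ¬ IsZeroForcingSet G (S : Set V) ↔ Fails G Finset.univ S := by
  classical
  constructor
  · intro h
    refine ⟨({w | ¬ Forced G S w} : Finset V), ⟨?_, Finset.subset_univ _, ?_⟩, ?_⟩
    · by_contra hne
      rw [Finset.not_nonempty_iff_eq_empty] at hne
      refine h (Set.eq_univ_of_forall fun w => ?_)
      by_contra hw
      change ¬ Forced G S w at hw
      have : w ∈ ({w | ¬ Forced G S w} : Finset V) := by simpa using hw
      simp [hne] at this
    · intro x _ hx w hw hxw
      simp only [Finset.mem_filter_univ, not_not] at hx hw ⊢
      by_contra hno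
      push Not at hno
      exact hw (Forced.force hx hxw fun y hy hyw => by
        by_contra hny
        exact hno y hny hyw hy)
    · rw [Finset.disjoint_left]
      intro a ha
      simpa using Forced.init (G := G) (Finset.mem_coe.mpr ha)
  · rintro ⟨F, ⟨⟨f, hf⟩, -, hF⟩, hSF⟩ h
    have key : ∀ w, Forced G S w → w ∉ F := by
      intro w hw
      induction hw with
      | init hw => exact Finset.disjoint_left.mp hSF (by simpa using hw)
      | force _ hxw _ ihx ih =>
        intro hwF
        obtain ⟨y, hy, hyw, hxy⟩ := hF _ (Finset.mem_univ _) ihx _ hwF hxw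
        exact ih y hxy hyw hy
    exact key f (h.symm ▸ Set.mem_univ f : f ∈ closure G S) hf

theorem z_add_card_failing [Fintype V] (G : SimpleGraph V) (k : ℕ) :
    z G k + (failing G Finset.univ k).card = (Nat.card V).choose k := by
  classical
  have h : {S : Finset V | S.card = k ∧ IsZeroForcingSet G (S : Set V)} =
      (({S ∈ Finset.univ.powersetCard k | ¬ Fails G Finset.univ S} : Finset (Finset V)) :
        Set (Finset V)) := by
    ext S
    simp [← not_isZeroForcingSet_iff, Finset.mem_powersetCard]
  rw [z, h, Set.ncard_coe_finset, failing, add_comm, Nat.card_eq_fintype_card,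
    ← Finset.card_univ, ← Finset.card_powersetCard]
  exact Finset.card_filter_add_card_filter_not _

theorem Fails.map {G : SimpleGraph V} {H : SimpleGraph W} (f : G ↪g H) {U S : Finset V} :
    Fails H (U.map f.toEmbedding) (S.map f.toEmbedding) ↔ Fails G U S := by
  classical
  constructor
  · rintro ⟨F, ⟨hne, hFU, hF⟩, hSF⟩
    obtain ⟨F, rfl⟩ : ∃ F', F = Finset.map f.toEmbedding F' := by
      obtain ⟨F', -, h⟩ := Finset.subset_map_iff.mp hFU
      exact ⟨F', h⟩
    refine ⟨F, ⟨by simpa using hne, by simpa using hFU, ?_⟩, by simpa using hSF⟩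
    intro x hx hxF w hw hxw
    obtain ⟨y, hy, hyw, hxy⟩ := hF (f x) (by simpa using hx) (by simpa using hxF) (f w)
      (by simpa using hw) (by simpa using hxw)
    simp only [Finset.mem_map] at hy
    obtain ⟨y, hy, rfl⟩ := hy
    exact ⟨y, hy, fun h => hyw (by simp [h]), by simpa using hxy⟩
  · rintro ⟨F, ⟨hne, hFU, hF⟩, hSF⟩
    refine ⟨F.map f.toEmbedding, ⟨by simpa using hne, by simpa using hFU, ?_⟩, by simpa using hSF⟩
    intro x hx hxF w hw hxw
    simp only [Finset.mem_map] at hx hw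
    obtain ⟨x, hx, rfl⟩ := hx
    obtain ⟨w, hw, rfl⟩ := hw
    obtain ⟨y, hy, hyw, hxy⟩ := hF x hx (by simpa using hxF) w hw (by simpa using hxw)
    exact ⟨f y, by simpa using hy, by simpa using hyw, by simpa using hxy⟩

/-- Identifies counts relative to a subset `U` with counts in the induced subgraph, so that the
induction can stay inside one vertex type. -/
theorem card_failing_map {G : SimpleGraph V} {H : SimpleGraph W} (f : G ↪g H) (U : Finset V)
    (k : ℕ) : (failing H (U.map f.toEmbedding) k).card = (failing G U k).card := by
  classical
  rw [← Finset.card_map (Finset.mapEmbedding f.toEmbedding).toEmbedding]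
  congr 1
  ext S
  simp only [mem_failing, Finset.mem_map]
  constructor
  · rintro ⟨⟨hS, rfl⟩, hf⟩
    obtain ⟨S, -, rfl⟩ := Finset.subset_map_iff.mp hS
    exact ⟨S, ⟨⟨by simpa using hS, by simp⟩, (Fails.map f).mp hf⟩, rfl⟩
  · rintro ⟨S, ⟨⟨hS, rfl⟩, hf⟩, rfl⟩
    exact ⟨⟨by simpa [Finset.mapEmbedding] using hS, by simp [Finset.mapEmbedding]⟩,
      (Fails.map f).mpr hf⟩

/-- The number of failing sets of size `k` of the path on `n` vertices. -/
noncomputable def pathFail (n k : ℕ) : ℕ :=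
  (failing (SimpleGraph.pathGraph n) Finset.univ k).card

theorem card_failing_of_gt {G : SimpleGraph V} {U : Finset V} {k : ℕ} (hk : U.card < k) :
    (failing G U k).card = 0 := by
  simp [failing, Finset.powersetCard_eq_empty.mpr hk]

/-- Zero forcing and failing `k`-sets together number `n.choose k` in both graphs, so the inequality
reverses. For `k > n` the path count is zero, which removes the bound on `k`. -/
theorem pathExtremal_iff [Fintype V] (G : SimpleGraph V) :
    PathExtremal G ↔ ∀ k, pathFail (Nat.card V) k ≤ (failing G Finset.univ k).card := by
  have h := z_add_card_failing G
  have h' := z_add_card_failing (SimpleGraph.pathGraph (Nat.card V))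
  simp only [Nat.card_eq_fintype_card, Fintype.card_fin] at h h'
  constructor
  · intro H k
    rcases le_or_gt k (Nat.card V) with hk | hk
    · have := H k hk
      have := h k
      have := h' k
      simp only [Nat.card_eq_fintype_card, pathFail] at *
      omega
    · rw [pathFail, card_failing_of_gt (by simpa using hk)]
      exact Nat.zero_le _
  · intro H k _
    have := H k
    have := h k
    have := h' k
    simp only [Nat.card_eq_fintype_card, pathFail] at *
    omega

/-! ### Forts from isolated vertices, twins and pendant vertices -/

theorem Fails.of_isolated {G : SimpleGraph V} {U S : Finset V} {x : V} (hx : x ∈ U)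
    (hiso : ∀ y ∈ U, ¬ G.Adj x y) (hS : x ∉ S) : Fails G U S := by
  refine ⟨{x}, ⟨by simp, by simpa using hx, ?_⟩, by simpa using hS⟩
  intro y hy _ w hw hyw
  rw [Finset.mem_singleton] at hw
  subst hw
  exact (hiso y hy hyw.symm).elim

/-- The pair is a fort, since every other vertex sees both or neither. Whether the twins are
adjacent is irrelevant. -/
theorem Fails.of_twins {G : SimpleGraph V} {U S : Finset V} {x y : V} (hx : x ∈ U) (hy : y ∈ U)
    (hxy : x ≠ y) (htwin : ∀ w ∈ U, w ≠ x → w ≠ y → (G.Adj x w ↔ G.Adj y w)) (hxS : x ∉ S)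
    (hyS : y ∉ S) : Fails G U S := by
  classical
  refine ⟨{x, y}, ⟨by simp, by simp [Finset.insert_subset_iff, hx, hy], ?_⟩, by simp [hxS, hyS]⟩
  intro a ha haF w hw haw
  simp only [Finset.mem_insert, Finset.mem_singleton, not_or] at haF hw
  have := htwin a ha haF.1 haF.2
  rcases hw with rfl | rfl
  · exact ⟨y, by simp, hxy.symm, (this.mp haw.symm).symm⟩
  · exact ⟨x, by simp, hxy, (this.mpr haw.symm).symm⟩

theorem choose_le_card_failing [DecidableEq V] {G : SimpleGraph V} {U A : Finset V} (hA : A ⊆ U)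
    (h : ∀ S ⊆ U, Disjoint A S → Fails G U S) (k : ℕ) :
    (U.card - A.card).choose k ≤ (failing G U k).card := by
  rw [← Finset.card_sdiff_of_subset hA, ← Finset.card_powersetCard]
  refine Finset.card_le_card fun S hS => ?_
  rw [Finset.mem_powersetCard] at hS
  have hSU := hS.1.trans Finset.sdiff_subset
  exact mem_failing.mpr ⟨⟨hSU, hS.2⟩, h S hSU
    (Finset.disjoint_left.mpr fun a ha haS => (Finset.mem_sdiff.mp (hS.1 haS)).2 ha)⟩

/-- A fort containing `c` remains one once `p` is added; a fort avoiding `c` is not seen by `p` at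
all. -/
theorem Fails.of_erase_pendant [DecidableEq V] {G : SimpleGraph V} {U S : Finset V} {p c : V}
    (hp : p ∈ U) (hpend : ∀ y ∈ U, G.Adj p y → y = c) (hS : S ⊆ U.erase p)
    (h : Fails G (U.erase p) S) : Fails G U S := by
  obtain ⟨F, ⟨hne, hFU, hF⟩, hSF⟩ := h
  have hpF : p ∉ F := fun h => by simpa using hFU h
  have hpS : p ∉ S := fun h => by simpa using hS h
  by_cases hc : c ∈ F
  · refine ⟨insert p F, ⟨by simp, Finset.insert_subset hp (hFU.trans (Finset.erase_subset _ _)), ?_⟩,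
      by simp [hpS, hSF]⟩
    intro x hx hxF w hw hxw
    simp only [Finset.mem_insert, not_or] at hxF hw
    rcases hw with rfl | hw
    · exact absurd (hpend x hx hxw.symm ▸ hc) hxF.2
    · obtain ⟨y, hy, h⟩ := hF x (by simp [hx, hxF.1]) hxF.2 w hw hxw
      exact ⟨y, by simp [hy], h⟩
  · refine ⟨F, ⟨hne, hFU.trans (Finset.erase_subset _ _), ?_⟩, hSF⟩
    intro x hx hxF w hw hxw
    by_cases hxp : x = p
    · subst hxp
      exact absurd (hpend w (Finset.mem_of_mem_erase (hFU hw)) hxw ▸ hw) hc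
    · exact hF x (by simp [hx, hxp]) hxF w hw hxw

/-- Removing a pendant vertex `p` with neighbour `c`, the numbers of failing sets obey the
recurrence that holds with equality for paths. -/
theorem card_failing_pendant [DecidableEq V] {G : SimpleGraph V} {U : Finset V} {p c : V}
    (hp : p ∈ U) (hc : c ∈ U) (hpc : G.Adj p c) (hpend : ∀ y ∈ U, G.Adj p y → y = c) (k : ℕ) :
    (failing G (U.erase p) (k + 1)).card + (failing G ((U.erase p).erase c) k).card ≤
      (failing G U (k + 1)).card := by
  classical
  set J := (U.erase p).erase c with hJ
  have hne : p ≠ c := hpc.ne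
  have hJp : ∀ S ⊆ J, p ∉ S := fun S hS h => by simpa [hJ] using hS h
  have hJc : ∀ S ⊆ J, c ∉ S := fun S hS h => by simpa [hJ] using hS h
  have hJU : J ⊆ U := (Finset.erase_subset _ _).trans (Finset.erase_subset _ _)
  -- An injection from the failing `k`-sets of `J` to the failing `(k+1)`-sets of `U` that do not
  -- fail in `U \ {p}`. Erasing `p` and `c` recovers `S`.
  let g : Finset V → Finset V := fun S => if Fails G U (insert p S) then insert p S else insert c S
  have hg : ∀ S ∈ failing G J k, g S ∈ failing G U (k + 1) \ failing G (U.erase p) (k + 1) := by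
    intro S hS
    obtain ⟨⟨hSJ, rfl⟩, F, ⟨hFne, hFJ, hF⟩, hSF⟩ := mem_failing.mp hS
    by_cases h : Fails G U (insert p S)
    · simp only [g, if_pos h, Finset.mem_sdiff, mem_failing]
      refine ⟨⟨⟨Finset.insert_subset hp (hSJ.trans hJU), Finset.card_insert_of_notMem (hJp S hSJ)⟩,
        h⟩, fun h' => ?_⟩
      simpa using h'.1.1 (Finset.mem_insert_self p S)
    · simp only [g, if_neg h, Finset.mem_sdiff, mem_failing]
      refine ⟨⟨⟨Finset.insert_subset hc (hSJ.trans hJU), Finset.card_insert_of_notMem (hJc S hSJ)⟩,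
        ?_⟩, fun h' => ?_⟩
      -- If `c` did not have exactly one neighbour in `F`, then `F` would be a fort of `U` missing
      -- `insert p S`. So `c` has a neighbour in `F`, and adding `p` gives it a second one.
      · have hex : ∃ w ∈ F, G.Adj c w ∧ ∀ y ∈ F, y ≠ w → ¬ G.Adj c y := by
          by_contra hno
          push Not at hno
          refine h ⟨F, ⟨hFne, hFJ.trans hJU, ?_⟩, by simp [hJp F hFJ, hSF]⟩
          intro x hx hxF w hw hxw
          by_cases hxp : x = p
          · subst hxp
            exact absurd (hpend w (hJU (hFJ hw)) hxw ▸ hw) (hJc F hFJ)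
          by_cases hxc : x = c
          · subst hxc
            exact hno w hw hxw
          · exact hF x (by simp [hJ, hx, hxp, hxc]) hxF w hw hxw
        obtain ⟨w₀, hw₀, hcw₀, -⟩ := hex
        refine ⟨insert p F, ⟨by simp, Finset.insert_subset hp (hFJ.trans hJU), ?_⟩, ?_⟩
        · intro x hx hxF w hw hxw
          simp only [Finset.mem_insert, not_or] at hxF hw
          by_cases hxc : x = c
          · subst hxc
            rcases hw with rfl | hw
            · exact ⟨w₀, by simp [hw₀], fun h => hxF.2.elim (by
                exact absurd (h ▸ hw₀) (hJp F hFJ)), hcw₀⟩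
            · exact ⟨p, by simp, fun h => hJp F hFJ (h ▸ hw), hpc.symm⟩
          · rcases hw with rfl | hw
            · exact absurd (hpend x hx hxw.symm) hxc
            · obtain ⟨y, hy, h⟩ := hF x (by simp [hJ, hx, hxF.1, hxc]) hxF.2 w hw hxw
              exact ⟨y, by simp [hy], h⟩
        · simp [hJp S hSJ, hJc F hFJ, hSF, hne]
      -- A fort avoiding `c` is unseen by `p`, so it stays a fort in `U` and misses `insert p S`,
      -- contrary to `h`.
      · obtain ⟨-, F', ⟨hFne', hFU', hF'⟩, hSF'⟩ := h'
        rw [Finset.disjoint_insert_left] at hSF'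
        have hpF' : p ∉ F' := fun h => by simpa using hFU' h
        refine h ⟨F', ⟨hFne', hFU'.trans (Finset.erase_subset _ _), ?_⟩, by simp [hpF', hSF'.2]⟩
        intro x hx hxF w hw hxw
        by_cases hxp : x = p
        · subst hxp
          exact absurd (hpend w (Finset.mem_of_mem_erase (hFU' hw)) hxw ▸ hw) hSF'.1
        · exact hF' x (by simp [hx, hxp]) hxF w hw hxw
  have hgrec : ∀ S ⊆ J, ((g S).erase p).erase c = S := by
    intro S hS
    have h1 := hJp S hS
    have h2 := hJc S hS
    simp only [g]
    split_ifs
    · rw [Finset.erase_insert h1, Finset.erase_eq_of_notMem h2]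
    · rw [Finset.erase_insert_of_ne hne.symm, Finset.erase_insert (by simp [h2]),
        Finset.erase_eq_of_notMem h1]
  have h1 : (failing G J k).card ≤ (failing G U (k + 1) \ failing G (U.erase p) (k + 1)).card := by
    refine Finset.card_le_card_of_injOn g hg fun S hS S' hS' h => ?_
    have e1 := hgrec S (mem_failing.mp hS).1.1
    have e2 := hgrec S' (mem_failing.mp hS').1.1
    rw [← e1, ← e2, h]
  have h2 : failing G (U.erase p) (k + 1) ⊆ failing G U (k + 1) := by
    intro S hS
    rw [mem_failing] at hS ⊢
    exact ⟨⟨hS.1.1.trans (Finset.erase_subset _ _), hS.1.2⟩,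
      Fails.of_erase_pendant hp hpend hS.1.1 hS.2⟩
  rw [Finset.card_sdiff_of_subset h2] at h1
  have := Finset.card_le_card h2
  omega

end ZeroForcing

/-! ### Failing sets of the path -/

namespace ZeroForcing

/-- The hypothesis on the predecessor covers both ways a run upwards starts: it is vacuous at the
end `i = 0`, and otherwise supplies two consecutive blue vertices. -/
theorem forced_path_up {n : ℕ} {S : Set (Fin n)} {i : ℕ} (hi : i < n)
    (h : Forced (SimpleGraph.pathGraph n) S ⟨i, hi⟩)
    (h' : ∀ j (hj : j < n), j + 1 = i → Forced (SimpleGraph.pathGraph n) S ⟨j, hj⟩) :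
    ∀ m (hm : i + m < n), Forced (SimpleGraph.pathGraph n) S ⟨i + m, hm⟩ := by
  intro m
  induction m using Nat.strong_induction_on with
  | _ m ih =>
    intro hm
    rcases m with - | m
    · exact h
    refine Forced.force (ih m (by omega) (by omega)) ?_ ?_
    · rw [SimpleGraph.pathGraph_adj]
      simp; omega
    · rintro ⟨y, hy⟩ hadj hne
      rw [SimpleGraph.pathGraph_adj] at hadj
      simp only [ne_eq, Fin.mk.injEq] at hadj hne
      rcases m with - | m
      · exact h' y hy (by omega)
      · obtain rfl : y = i + m := by omega
        exact ih m (by omega) _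

theorem forced_path_down {n : ℕ} {S : Set (Fin n)} {i : ℕ} (hi : i < n)
    (h : Forced (SimpleGraph.pathGraph n) S ⟨i, hi⟩)
    (h' : ∀ hj : i + 1 < n, Forced (SimpleGraph.pathGraph n) S ⟨i + 1, hj⟩) :
    ∀ m (hm : m ≤ i), Forced (SimpleGraph.pathGraph n) S ⟨i - m, by omega⟩ := by
  intro m
  induction m using Nat.strong_induction_on with
  | _ m ih =>
    intro hm
    rcases m with - | m
    · exact h
    refine Forced.force (ih m (by omega) (by omega)) ?_ ?_
    · rw [SimpleGraph.pathGraph_adj]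
      simp; omega
    · rintro ⟨y, hy⟩ hadj hne
      rw [SimpleGraph.pathGraph_adj] at hadj
      simp only [ne_eq, Fin.mk.injEq] at hadj hne
      rcases m with - | m
      · obtain rfl : y = i + 1 := by omega
        exact h' hy
      · obtain rfl : y = i - m := by omega
        exact ih m (by omega) (by omega)

/-- The failing sets of the path on `n` vertices, as sets of natural numbers below `n`: they
contain no end and no two consecutive vertices. -/
def pathFailing (n k : ℕ) : Finset (Finset ℕ) :=
  {S ∈ (Finset.range n).powersetCard k | 0 < n ∧ ∀ i ∈ S, 0 < i ∧ i + 1 < n ∧ i + 1 ∉ S}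

theorem fails_pathGraph_iff {n : ℕ} (S : Finset (Fin n)) :
    Fails (SimpleGraph.pathGraph n) Finset.univ S ↔ 0 < n ∧
      ∀ i ∈ S.map Fin.valEmbedding, 0 < i ∧ i + 1 < n ∧ i + 1 ∉ S.map Fin.valEmbedding := by
  constructor
  · intro h
    have hn : 0 < n := by
      obtain ⟨F, ⟨⟨f, -⟩, -⟩, -⟩ := h
      exact f.pos
    rw [← not_isZeroForcingSet_iff] at h
    refine ⟨hn, ?_⟩
    simp only [Finset.mem_map, Fin.valEmbedding_apply]
    rintro _ ⟨i, hi, rfl⟩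
    have hfi : Forced (SimpleGraph.pathGraph n) S i := .init hi
    refine ⟨?_, ?_, ?_⟩
    · by_contra h0
      refine h (Set.eq_univ_of_forall fun w => ?_)
      have := forced_path_up i.2 hfi (fun j hj hji => by omega) (w - i) (by omega)
      change Forced _ _ w
      convert this using 1
      ext; simp; omega
    · by_contra h0
      refine h (Set.eq_univ_of_forall fun w => ?_)
      have := forced_path_down i.2 hfi (fun hj => by omega) (i - w) (by omega)
      change Forced _ _ w
      convert this using 1
      ext; simp; omega
    · rintro ⟨j, hj, hji⟩
      have hfj : Forced (SimpleGraph.pathGraph n) S j := .init hj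
      refine h (Set.eq_univ_of_forall fun w => ?_)
      rcases le_or_gt w i with hw | hw
      · have := forced_path_down i.2 hfi (fun hj' => by
          convert hfj using 1; ext; simp [hji]) (i - w) (by omega)
        change Forced _ _ w
        convert this using 1
        ext; simp; omega
      · have := forced_path_up j.2 hfj (fun k hk hkj => by
          convert hfi using 1; ext; simp; omega) (w - j) (by omega)
        change Forced _ _ w
        convert this using 1
        ext; simp; omega
  · rintro ⟨hn, h⟩
    simp only [Finset.mem_map, Fin.valEmbedding_apply] at h
    -- Every vertex of `S` is interior with both neighbours outside `S`, so the complement is a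
    -- fort; it contains the end `0`.
    refine ⟨Sᶜ, ⟨⟨⟨0, hn⟩, ?_⟩, Finset.subset_univ _, ?_⟩, disjoint_compl_right⟩
    · rw [Finset.mem_compl]
      intro h0
      simpa using (h _ ⟨_, h0, rfl⟩).1
    · intro x _ hx w _ hxw
      rw [Finset.mem_compl, not_not] at hx
      obtain ⟨h1, h2, h3⟩ := h _ ⟨x, hx, rfl⟩
      rw [SimpleGraph.pathGraph_adj] at hxw
      rcases hxw with hxw | hxw
      · refine ⟨⟨x - 1, by omega⟩, ?_, ?_, ?_⟩
        · rw [Finset.mem_compl]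
          intro hm
          exact (h _ ⟨_, hm, rfl⟩).2.2 ⟨x, hx, by simp; omega⟩
        · rw [ne_eq, Fin.ext_iff]; simp; omega
        · rw [SimpleGraph.pathGraph_adj]; simp; omega
      · refine ⟨⟨x + 1, by omega⟩, ?_, ?_, ?_⟩
        · rw [Finset.mem_compl]
          intro hm
          exact h3 ⟨_, hm, rfl⟩
        · rw [ne_eq, Fin.ext_iff]; simp; omega
        · rw [SimpleGraph.pathGraph_adj]; simp

theorem pathFail_eq (n k : ℕ) : pathFail n k = (pathFailing n k).card := by
  rw [pathFail, ← Finset.card_map (Finset.mapEmbedding Fin.valEmbedding).toEmbedding]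
  congr 1
  ext S
  simp only [pathFailing, Finset.mem_filter, Finset.mem_map, mem_failing, fails_pathGraph_iff,
    Finset.mem_powersetCard]
  constructor
  · rintro ⟨S, ⟨⟨-, rfl⟩, hf⟩, rfl⟩
    refine ⟨⟨?_, by simp [Finset.mapEmbedding]⟩, ?_⟩
    · intro i
      simp only [RelEmbedding.coe_toEmbedding, Finset.mapEmbedding_apply, Finset.mem_map]
      rintro ⟨j, -, rfl⟩
      simp
    · simpa only [RelEmbedding.coe_toEmbedding, Finset.mapEmbedding_apply, Finset.mem_map] using hf
  · rintro ⟨⟨hS, rfl⟩, hf⟩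
    have hS' : S ⊆ Finset.univ.map (Fin.valEmbedding (n := n)) := by
      intro i hi
      simpa [Fin.exists_iff] using hS hi
    obtain ⟨S', -, rfl⟩ := Finset.subset_map_iff.mp hS'
    exact ⟨S', ⟨⟨Finset.subset_univ _, by simp⟩, by simpa using hf⟩, rfl⟩

theorem pathFail_le_choose {n : ℕ} (hn : 0 < n) (k : ℕ) :
    pathFail n k ≤ (n - 2).choose k := by
  rw [pathFail_eq, show n - 2 = (Finset.Ioo 0 (n - 1)).card by simp; omega,
    ← Finset.card_powersetCard]
  refine Finset.card_le_card fun S hS => ?_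
  simp only [pathFailing, Finset.mem_filter, Finset.mem_powersetCard] at hS ⊢
  refine ⟨fun i hi => ?_, hS.1.2⟩
  have := hS.2.2 i hi
  rw [Finset.mem_Ioo]
  omega

theorem pathFail_zero_le (n : ℕ) : pathFail n 0 ≤ 1 := by
  rw [pathFail_eq, pathFailing]
  exact (Finset.card_filter_le _ _).trans (by simp)

/-- Case distinction on the last interior vertex `n`. If `n ∉ S`, then `S` fails on the path with
one vertex fewer. If `n ∈ S`, then `n - 1 ∉ S`, and removing `n` leaves a failing set of the path on
`n` vertices. -/
theorem pathFail_le_add (n k : ℕ) :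
    pathFail (n + 2) (k + 1) ≤ pathFail (n + 1) (k + 1) + pathFail n k := by
  simp only [pathFail_eq]
  have h1 : {S ∈ pathFailing (n + 2) (k + 1) | n ∉ S} ⊆ pathFailing (n + 1) (k + 1) := by
    intro S hS
    simp only [pathFailing, Finset.mem_filter, Finset.mem_powersetCard] at hS ⊢
    obtain ⟨⟨⟨-, hc⟩, -, h⟩, hn⟩ := hS
    have hlt : ∀ i ∈ S, i < n := fun i hi => by
      have := h i hi
      have : i ≠ n := fun e => hn (e ▸ hi)
      omega
    refine ⟨⟨fun i hi => ?_, hc⟩, by omega, fun i hi => ?_⟩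
    · have := hlt i hi
      simp; omega
    · have := hlt i hi
      have := h i hi
      exact ⟨this.1, by omega, this.2.2⟩
  have h2 : ({S ∈ pathFailing (n + 2) (k + 1) | ¬ n ∉ S}).card ≤ (pathFailing n k).card := by
    refine Finset.card_le_card_of_injOn (fun S => S.erase n) ?_ ?_
    · intro S hS
      simp only [pathFailing, Finset.coe_filter, Set.mem_ofPred_eq, Finset.mem_filter,
        Finset.mem_powersetCard, not_not, Finset.mem_erase] at hS ⊢
      obtain ⟨⟨⟨-, hc⟩, -, h⟩, hn⟩ := hS
      have hlt : ∀ i ∈ S, i ≠ n → i + 1 < n := fun i hi hin => by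
        have h' := h i hi
        have : i + 1 ≠ n := fun e => h'.2.2 (e ▸ hn)
        omega
      refine ⟨⟨fun i hi => ?_, by rw [Finset.card_erase_of_mem hn, hc]; rfl⟩, (h n hn).1,
        fun i hi => ?_⟩
      · rw [Finset.mem_erase] at hi
        have := hlt i hi.2 hi.1
        simp; omega
      · exact ⟨(h i hi.2).1, hlt i hi.2 hi.1, fun h' => (h i hi.2).2.2 h'.2⟩
    · intro S hS S' hS' e
      simp only [Finset.coe_filter, Set.mem_ofPred_eq, not_not] at hS hS'
      have := congrArg (insert n) e
      simpa [Finset.insert_erase hS.2, Finset.insert_erase hS'.2] using this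
  rw [← Finset.card_filter_add_card_filter_not (s := pathFailing (n + 2) (k + 1)) (n ∉ ·)]
  exact Nat.add_le_add (Finset.card_le_card h1) h2

end ZeroForcing

/-! ### Projecting vertices to a bag -/

namespace SplitDecomposition.GraphLabelledTree

variable {V : Type u} (T : GraphLabelledTree V)

theorem accessibleAlong_append_cons {a b c d : T.Bag} (p : T.tree.Walk a b) (h : T.tree.Adj b c)
    (q : T.tree.Walk c d) (x : T.LabelVertex a) (y : T.LabelVertex d) :
    T.AccessibleAlong (p.append (.cons h q)) x y ↔
      T.AccessibleAlong p x (T.marker h) ∧ T.AccessibleAlong q (T.marker h.symm) y := by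
  induction p with
  | nil => rfl
  | cons h' p ih => simp only [SimpleGraph.Walk.cons_append, AccessibleAlong, ih, and_assoc]

theorem accessibleAlong_reverse {a b : T.Bag} (p : T.tree.Walk a b) (x : T.LabelVertex a)
    (y : T.LabelVertex b) : T.AccessibleAlong p.reverse y x ↔ T.AccessibleAlong p x y := by
  induction p with
  | nil => exact (T.label _).adj_comm _ _
  | cons h p ih =>
    rw [SimpleGraph.Walk.reverse_cons, accessibleAlong_append_cons, ih, AccessibleAlong,
      AccessibleAlong, SimpleGraph.adj_comm, and_comm]

/-- The label vertex of `b` which represents the label vertex `x` at the end of the walk. -/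
def represent {b : T.Bag} : {c : T.Bag} → T.tree.Walk b c → T.LabelVertex c → T.LabelVertex b
  | _, .nil, x => x
  | _, .cons h _, _ => T.marker h

/-- The label vertex `x` at the end of the walk is accessible from its first bag. -/
def Linked {b : T.Bag} : {c : T.Bag} → T.tree.Walk b c → T.LabelVertex c → Prop
  | _, .nil, _ => True
  | _, .cons h q, x => T.AccessibleAlong q (T.marker h.symm) x

theorem accessibleAlong_iff_linked {b c : T.Bag} (q : T.tree.Walk b c) (y : T.LabelVertex b)
    (x : T.LabelVertex c) :
    T.AccessibleAlong q y x ↔ T.Linked q x ∧ (T.label b).Adj y (T.represent q x) := by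
  cases q with
  | nil => simp [AccessibleAlong, Linked, represent]
  | cons h q => rw [AccessibleAlong, Linked, represent, and_comm]

theorem accessibleAlong_reverse_append {b c d : T.Bag} (p : T.tree.Walk b c) (q : T.tree.Walk b d)
    (x : T.LabelVertex c) (y : T.LabelVertex d) :
    T.AccessibleAlong (p.reverse.append q) x y ↔
      T.Linked p x ∧ T.Linked q y ∧ (T.label b).Adj (T.represent p x) (T.represent q y) := by
  cases p with
  | nil =>
    rw [SimpleGraph.Walk.reverse_nil, SimpleGraph.Walk.nil_append, accessibleAlong_iff_linked]
    exact (iff_of_eq (true_and _)).symm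
  | cons h p =>
    rw [SimpleGraph.Walk.reverse_cons, ← SimpleGraph.Walk.append_assoc, SimpleGraph.Walk.cons_append,
      SimpleGraph.Walk.nil_append, accessibleAlong_append_cons, accessibleAlong_reverse,
      accessibleAlong_iff_linked T q]
    rfl

/-- In a tree a walk is a path once consecutive edges differ. At the junction they differ because
equal first edges would give the same marker. -/
theorem isPath_reverse_append {b c d : T.Bag} {p : T.tree.Walk b c} {q : T.tree.Walk b d}
    (hp : p.IsPath) (hq : q.IsPath) {x : T.LabelVertex c} {y : T.LabelVertex d}
    (h : T.represent p x ≠ T.represent q y) : (p.reverse.append q).IsPath := by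
  rw [T.isTree.isAcyclic.isPath_iff_isChain, SimpleGraph.Walk.edges_append,
    List.isChain_append]
  refine ⟨(T.isTree.isAcyclic.isPath_iff_isChain _).mp hp.reverse,
    (T.isTree.isAcyclic.isPath_iff_isChain _).mp hq, ?_⟩
  intro e he f hf hef
  rw [SimpleGraph.Walk.edges_reverse, List.getLast?_reverse] at he
  cases p with
  | nil => simp at he
  | cons h₁ p =>
    cases q with
    | nil => simp at hf
    | cons h₂ q =>
      simp only [SimpleGraph.Walk.edges_cons, List.head?_cons, Option.mem_some_iff] at he hf
      subst he hf
      rw [Sym2.congr_right] at hef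
      subst hef
      exact h rfl

/-- The path of the tree from the bag `b` to the bag of `w`. -/
noncomputable def pathTo (b : T.Bag) (w : V) : T.tree.Walk b (T.home w) :=
  (T.isTree.existsUnique_path b (T.home w)).choose

theorem pathTo_isPath (b : T.Bag) (w : V) : (T.pathTo b w).IsPath :=
  (T.isTree.existsUnique_path b (T.home w)).choose_spec.1

theorem eq_pathTo {b : T.Bag} {w : V} {p : T.tree.Walk b (T.home w)} (hp : p.IsPath) :
    p = T.pathTo b w :=
  (T.isTree.existsUnique_path b (T.home w)).choose_spec.2 p hp

/-- The vertex of the label graph of `b` that stands for the ordinary vertex `w`: either `w`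
itself, or the marker of `b` towards the bag of `w`. -/
noncomputable def proj (b : T.Bag) (w : V) : T.LabelVertex b :=
  T.represent (T.pathTo b w) (T.ordinary w)

/-- The ordinary vertex `w` is accessible from the bag `b`. -/
def LinkedTo (b : T.Bag) (w : V) : Prop :=
  T.Linked (T.pathTo b w) (T.ordinary w)

variable {T}

/-- When the images in `b` differ, the tree path between the two home bags passes through `b`, so
adjacency can be read off in the label of `b`. -/
theorem Represents.adj_iff {G : SimpleGraph V} (hG : T.Represents G) {b : T.Bag} {x y : V}
    (h : T.proj b x ≠ T.proj b y) :
    G.Adj x y ↔ T.LinkedTo b x ∧ T.LinkedTo b y ∧ (T.label b).Adj (T.proj b x) (T.proj b y) := by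
  have hp := T.isPath_reverse_append (T.pathTo_isPath b x) (T.pathTo_isPath b y) h
  rw [hG x y]
  refine Iff.trans ⟨?_, fun h => ⟨_, hp, h⟩⟩ (T.accessibleAlong_reverse_append _ _ _ _)
  rintro ⟨p, hp', h⟩
  rwa [(T.isTree.existsUnique_path _ _).unique hp' hp] at h

theorem exists_eq_cons {b c d : T.Bag} {h : T.tree.Adj b c} {w : {w : V // T.home w = d}}
    (p : T.tree.Walk b d) (hp : T.represent p (Sum.inl w) = T.marker h) : ∃ q, p = .cons h q := by
  cases p with
  | nil => cases hp
  | cons h' p =>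
    have := congrArg Subtype.val (Sum.inr_injective hp)
    dsimp only at this
    subst this
    exact ⟨p, rfl⟩

/-- A tree edge separates: a vertex beyond `c` as seen from `b` cannot be beyond `b` as seen from
`c`. -/
theorem proj_ne_of_proj_eq {b c : T.Bag} {h : T.tree.Adj b c} {w : V}
    (hw : T.proj b w = T.marker h) : T.proj c w ≠ T.marker h.symm := by
  intro hc
  obtain ⟨q, hq⟩ := exists_eq_cons _ hw
  obtain ⟨r, hr⟩ := exists_eq_cons _ hc
  have hp := T.pathTo_isPath b w
  rw [hq, SimpleGraph.Walk.cons_isPath_iff] at hp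
  rw [T.eq_pathTo hp.1, hr] at hp
  simp at hp

theorem represent_eq_marker_or {b d : T.Bag} (w : {w : V // T.home w = d}) (p : T.tree.Walk b d) :
    (∃ (c : T.Bag) (h : T.tree.Adj b c), T.represent p (Sum.inl w) = T.marker h) ∨
      ∃ e, T.represent p (Sum.inl w) = Sum.inl ⟨w.1, e⟩ := by
  cases p with
  | nil => exact .inr ⟨w.2, rfl⟩
  | cons h p => exact .inl ⟨_, h, rfl⟩

theorem exists_proj_eq_marker {b : T.Bag} {x y : V} (hxy : x ≠ y) (h : T.proj b x = T.proj b y) :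
    ∃ (c : T.Bag) (hc : T.tree.Adj b c), T.proj b x = T.marker hc := by
  rcases T.represent_eq_marker_or ⟨x, rfl⟩ (T.pathTo b x) with hx | ⟨e, hx⟩
  · exact hx
  rcases T.represent_eq_marker_or ⟨y, rfl⟩ (T.pathTo b y) with ⟨c, hc, hy⟩ | ⟨e', hy⟩
  · exact ⟨c, hc, h.trans hy⟩
  · have := hx.symm.trans (h.trans hy)
    exact absurd (congrArg Subtype.val (Sum.inl_injective this)) hxy

theorem eq_of_dist_add_one {r b c d : T.Bag} (hb : T.tree.Adj c b) (hd : T.tree.Adj c d)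
    (hb' : T.tree.dist b r + 1 = T.tree.dist c r) (hd' : T.tree.dist d r + 1 = T.tree.dist c r) :
    b = d := by
  obtain ⟨p, hp⟩ := (T.isTree.connected b r).exists_walk_length_eq_dist
  obtain ⟨q, hq⟩ := (T.isTree.connected d r).exists_walk_length_eq_dist
  have h1 : (p.cons hb).IsPath :=
    SimpleGraph.Walk.isPath_of_length_eq_dist _ (by simp [hp, hb'])
  have h2 : (q.cons hd).IsPath :=
    SimpleGraph.Walk.isPath_of_length_eq_dist _ (by simp [hq, hd'])
  have := (T.isTree.existsUnique_path c r).unique h1 h2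
  simpa using congrArg SimpleGraph.Walk.snd this

theorem dist_eq_add_one {r b c d : T.Bag} (hb : T.tree.Adj c b) (hd : T.tree.Adj c d)
    (hb' : T.tree.dist b r + 1 = T.tree.dist c r) (hbd : b ≠ d) :
    T.tree.dist d r = T.tree.dist c r + 1 := by
  have := T.isTree.dist_eq_dist_add_one_of_adj r hd
  rw [SimpleGraph.dist_comm (u := r), SimpleGraph.dist_comm (u := r)] at this
  rcases this with h | h
  · exact absurd (T.eq_of_dist_add_one hb hd hb' h.symm) hbd
  · exact h

end SplitDecomposition.GraphLabelledTree

/-! ### Extremality on vertex subsets -/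

namespace ZeroForcing

/-- `G` restricted to `U` has at least as many failing sets of every size as the path. -/
def ExtremalOn {V : Type u} (G : SimpleGraph V) (U : Finset V) : Prop :=
  ∀ k, pathFail U.card k ≤ (failing G U k).card

theorem ExtremalOn.of_embedding {V : Type u} {W : Type v} [Fintype W] {G : SimpleGraph V}
    {U : Finset V} {H : SimpleGraph W} (hind : ∀ s : Set W, PathExtremal (H.induce s))
    (f : G.induce (U : Set V) ↪g H) : ExtremalOn G U := by
  classical
  have hs := (pathExtremal_iff _).mp (hind (Set.range f))
  have h1 : (Finset.univ : Finset (U : Set V)).map f.toEmbedding =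
      Finset.univ.map (SimpleGraph.Embedding.induce (G := H) (Set.range f)).toEmbedding := by
    ext w
    simp [SimpleGraph.Embedding.induce]
  have h2 : (Finset.univ : Finset (U : Set V)).map
      (SimpleGraph.Embedding.induce (G := G) (U : Set V)).toEmbedding = U := by
    ext w
    simp [SimpleGraph.Embedding.induce]
  intro k
  have h3 := card_failing_map f Finset.univ k
  have h5 := card_failing_map (SimpleGraph.Embedding.induce (G := G) (U : Set V)) Finset.univ k
  rw [h2] at h5
  rw [h1, card_failing_map, ← h5] at h3
  have h4 : Nat.card (Set.range f) = U.card := by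
    rw [Nat.card_range_of_injective f.injective]
    simp
  have := hs k
  rwa [h4, h3] at this

theorem ExtremalOn.pathExtremal {V : Type u} [Fintype V] {G : SimpleGraph V}
    (h : ExtremalOn G Finset.univ) : PathExtremal G := by
  rw [pathExtremal_iff, Nat.card_eq_fintype_card]
  exact h

theorem ExtremalOn.of_isolated {V : Type u} {G : SimpleGraph V} {U : Finset V} {x : V}
    (hx : x ∈ U) (hiso : ∀ y ∈ U, ¬ G.Adj x y) : ExtremalOn G U := by
  classical
  intro k
  refine (pathFail_le_choose (Finset.card_pos.mpr ⟨x, hx⟩) k).trans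
    ((Nat.choose_le_choose k ?_).trans (choose_le_card_failing (Finset.singleton_subset_iff.mpr hx)
      (fun S _ hd => .of_isolated hx hiso (by simpa using hd)) k))
  rw [Finset.card_singleton]
  omega

theorem ExtremalOn.of_twins {V : Type u} {G : SimpleGraph V} {U : Finset V} {x y : V}
    (hx : x ∈ U) (hy : y ∈ U) (hxy : x ≠ y)
    (htwin : ∀ w ∈ U, w ≠ x → w ≠ y → (G.Adj x w ↔ G.Adj y w)) : ExtremalOn G U := by
  classical
  intro k
  refine (pathFail_le_choose (Finset.card_pos.mpr ⟨x, hx⟩) k).trans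
    (le_of_eq_of_le ?_ (choose_le_card_failing (A := {x, y})
      (by simp [Finset.insert_subset_iff, hx, hy]) (fun S _ hd => ?_) k))
  · rw [Finset.card_pair hxy]
  · simp only [Finset.disjoint_insert_left, Finset.disjoint_singleton_left] at hd
    exact .of_twins hx hy hxy htwin hd.1 hd.2

theorem ExtremalOn.of_pendant {V : Type u} {G : SimpleGraph V} {U : Finset V} {p c : V}
    (hp : p ∈ U) (hc : c ∈ U) (hpc : G.Adj p c) (hpend : ∀ y ∈ U, G.Adj p y → y = c)
    (ih : ∀ U' ⊂ U, ExtremalOn G U') : ExtremalOn G U := by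
  classical
  have hcp : c ∈ U.erase p := by simp [hc, hpc.ne.symm]
  have h1 := Finset.card_erase_add_one hp
  have h2 := Finset.card_erase_add_one hcp
  rintro (- | k)
  · refine (pathFail_zero_le _).trans (Finset.card_pos.mpr ⟨∅, mem_failing.mpr ⟨by simp, U, ?_⟩⟩)
    -- For size `0` the whole of `U` is a fort missed by the empty set.
    exact ⟨⟨⟨p, hp⟩, subset_rfl, fun x hx hx' => absurd hx hx'⟩, Finset.disjoint_empty_left _⟩
  · have e1 := ih _ (Finset.erase_ssubset hp) (k + 1)
    have e2 := ih _ ((Finset.erase_ssubset hcp).trans (Finset.erase_ssubset hp)) k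
    have e3 := pathFail_le_add ((U.erase p).erase c).card k
    rw [← h1, ← h2]
    rw [← h2] at e1
    exact e3.trans ((Nat.add_le_add e1 e2).trans (card_failing_pendant hp hc hpc hpend k))

end ZeroForcing

/-! ### Induction along the split decomposition -/

namespace SplitDecomposition.GraphLabelledTree

open ZeroForcing

variable {V : Type u} {T : GraphLabelledTree V} {G : SimpleGraph V}

theorem adj_iff_of_isStarWithCenter {α : Type u} {L : SimpleGraph α} {c : α} (h : IsStarWithCenter L c)
    (x y : α) : L.Adj x y ↔ x ≠ y ∧ (x = c ∨ y = c) := by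
  rw [h, SimpleGraph.starGraph_adj]

/-- If two vertices of `U` share their images in the label of a clique or star bag with no other
vertex of `U`, then they are twins, or one of them is isolated or pendant. -/
theorem extremalOn_of_private (hG : T.Represents G) {U : Finset V}
    (ih : ∀ U' ⊂ U, ExtremalOn G U') {b : T.Bag}
    (hb : IsCliqueGraph (T.label b) ∨ IsStar (T.label b)) {x y : V} (hx : x ∈ U) (hy : y ∈ U)
    (hxy : x ≠ y) (hx' : ∀ w ∈ U, w ≠ x → T.proj b w ≠ T.proj b x)
    (hy' : ∀ w ∈ U, w ≠ y → T.proj b w ≠ T.proj b y) : ExtremalOn G U := by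
  have hax : ∀ w ∈ U, G.Adj x w ↔
      T.LinkedTo b x ∧ T.LinkedTo b w ∧ (T.label b).Adj (T.proj b x) (T.proj b w) := by
    intro w hw
    by_cases hwx : w = x
    · subst hwx; simp
    · exact hG.adj_iff (hx' w hw hwx).symm
  have hay : ∀ w ∈ U, G.Adj y w ↔
      T.LinkedTo b y ∧ T.LinkedTo b w ∧ (T.label b).Adj (T.proj b y) (T.proj b w) := by
    intro w hw
    by_cases hwy : w = y
    · subst hwy; simp
    · exact hG.adj_iff (hy' w hw hwy).symm
  by_cases hlx : T.LinkedTo b x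
  swap
  · exact .of_isolated hx fun w hw h => hlx ((hax w hw).mp h).1
  by_cases hly : T.LinkedTo b y
  swap
  · exact .of_isolated hy fun w hw h => hly ((hay w hw).mp h).1
  rcases hb with hb | ⟨c, hb⟩
  · refine .of_twins hx hy hxy fun w hw hwx hwy => ?_
    rw [hax w hw, hay w hw, hb]
    simp [hlx, hly, (hx' w hw hwx).symm, (hy' w hw hwy).symm]
  -- If `x` alone in `U` is represented by the centre, then `y`, represented by a leaf, is pendant
  -- at `x`.
  have hpend : ∀ {x y : V}, x ∈ U → y ∈ U → x ≠ y → T.LinkedTo b x → T.LinkedTo b y →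
      (∀ w ∈ U, w ≠ x → T.proj b w ≠ T.proj b x) →
      (∀ w ∈ U, G.Adj y w ↔
        T.LinkedTo b y ∧ T.LinkedTo b w ∧ (T.label b).Adj (T.proj b y) (T.proj b w)) →
      T.proj b x = c → ExtremalOn G U := by
    intro x y hx hy hxy hlx hly hx' hay hxc
    have hne := hx' y hy hxy.symm
    refine .of_pendant hy hx ((hay x hx).mpr ⟨hly, hlx, ?_⟩) (fun w hw h => ?_) ih
    · rw [adj_iff_of_isStarWithCenter hb]
      exact ⟨hne, .inr hxc⟩
    · have := (adj_iff_of_isStarWithCenter hb _ _).mp ((hay w hw).mp h).2.2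
      by_contra hwx
      rcases this.2 with h | h
      · exact hne (h.trans hxc.symm)
      · exact hx' w hw hwx (h.trans hxc.symm)
  by_cases hxc : T.proj b x = c
  · exact hpend hx hy hxy hlx hly hx' hay hxc
  by_cases hyc : T.proj b y = c
  · exact hpend hy hx hxy.symm hly hlx hy' hax hyc
  refine .of_twins hx hy hxy fun w hw hwx hwy => ?_
  rw [hax w hw, hay w hw, adj_iff_of_isStarWithCenter hb, adj_iff_of_isStarWithCenter hb]
  simp [hlx, hly, hxc, hyc, (hx' w hw hwx).symm, (hy' w hw hwy).symm]

/-- If two vertices of `U` have the same image in the bag `r`, then some bag other than `r` has at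
least two vertices of `U` beyond it, seen from `r`, and these have distinct images in it. -/
theorem exists_deepest_bag (U : Finset V) {r : T.Bag} {x y : V} (hx : x ∈ U) (hy : y ∈ U)
    (hxy : x ≠ y) (h : T.proj r x = T.proj r y) :
    ∃ (b : T.Bag) (m : T.LabelVertex b), b ≠ r ∧
      (∃ x ∈ U, ∃ y ∈ U, x ≠ y ∧ T.proj b x ≠ m ∧ T.proj b y ≠ m) ∧
      ∀ x ∈ U, ∀ y ∈ U, T.proj b x = T.proj b y → T.proj b x ≠ m → x = y := by
  have := T.finite
  -- The bag `a` is the neighbour of `b` towards `r`, so an image other than its marker means lying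
  -- at `b` or beyond it.
  let P : T.Bag → Prop := fun b => ∃ (a : T.Bag) (hba : T.tree.Adj b a),
    T.tree.dist a r + 1 = T.tree.dist b r ∧
      ∃ x ∈ U, ∃ y ∈ U, x ≠ y ∧ T.proj b x ≠ T.marker hba ∧ T.proj b y ≠ T.marker hba
  have hP : {b | P b}.Nonempty := by
    obtain ⟨c, hc, hxc⟩ := T.exists_proj_eq_marker hxy h
    exact ⟨c, r, hc.symm, by simp [SimpleGraph.dist_eq_one_iff_adj.mpr hc.symm], x, hx, y, hy, hxy,
      T.proj_ne_of_proj_eq hxc, T.proj_ne_of_proj_eq (h ▸ hxc)⟩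
  obtain ⟨b, ⟨a, hba, hd, hex⟩, hmax⟩ :=
    Set.exists_max_image _ (fun b => T.tree.dist b r) (Set.toFinite _) hP
  refine ⟨b, T.marker hba, ?_, hex, ?_⟩
  · rintro rfl
    simp at hd
  · intro x hx y hy he hm
    -- Two vertices with a common image away from `r` lie beyond a neighbour `d` of `b` that is
    -- farther from `r`, against the choice of `b`.
    by_contra hxy
    obtain ⟨d, hbd, hxd⟩ := T.exists_proj_eq_marker hxy he
    have had : a ≠ d := by
      rintro rfl
      exact hm hxd
    have hdist := T.dist_eq_add_one hba hbd hd had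
    have := hmax d ⟨b, hbd.symm, hdist.symm, x, hx, y, hy, hxy,
      T.proj_ne_of_proj_eq hxd, T.proj_ne_of_proj_eq (he ▸ hxd)⟩
    omega

theorem extremalOn {W : Type v} [Finite W] {H : SimpleGraph W}
    (hind : ∀ s : Set W, PathExtremal (H.induce s)) (hG : T.Represents G) {r : T.Bag}
    (e : T.label r ≃g H)
    (hT : ∀ b ≠ r, IsCliqueGraph (T.label b) ∨ IsStar (T.label b)) (U : Finset V) :
    ExtremalOn G U := by
  have := Fintype.ofFinite W
  induction U using Finset.strongInduction with
  | H U ih =>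
    by_cases hinj : Set.InjOn (T.proj r) U
    · by_cases hl : ∀ x ∈ U, T.LinkedTo r x
      -- With all vertices linked and distinct images, `proj r` followed by `e` is an induced
      -- embedding of `G[U]` into `H`.
      · refine .of_embedding hind
          ⟨⟨fun x => e (T.proj r x), fun x y h => ?_⟩, @fun x y => ?_⟩
        · exact Subtype.ext (hinj x.2 y.2 (e.injective h))
        · change H.Adj (e _) (e _) ↔ G.Adj x y
          rw [e.map_adj_iff]
          by_cases hxy : x = y
          · subst hxy
            simp
          · rw [hG.adj_iff fun h => hxy (Subtype.ext (hinj x.2 y.2 h))]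
            simp [hl x x.2, hl y y.2]
      · push Not at hl
        obtain ⟨x, hx, hlx⟩ := hl
        refine .of_isolated hx fun y hy h => ?_
        exact hlx ((hG.adj_iff fun h' => h.ne (hinj hx hy h')).mp h).1
    · simp only [Set.InjOn, not_forall] at hinj
      obtain ⟨x₀, hx₀, y₀, hy₀, h₀, hne⟩ := hinj
      obtain ⟨b, m, hb, ⟨x, hx, y, hy, hxy, hxm, hym⟩, h⟩ :=
        exists_deepest_bag U hx₀ hy₀ hne h₀
      exact extremalOn_of_private hG ih (hT b hb) hx hy hxy
        (fun w hw hwx he => hwx (h x hx w hw he.symm hxm).symm)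
        (fun w hw hwy he => hwy (h y hy w hw he.symm hym).symm)

end SplitDecomposition.GraphLabelledTree

theorem mainTheorem2 {W : Type v} [Finite W] (H : SimpleGraph W)
    (hH : SplitDecomposition.SplitPrime H)
    (hind : ∀ s : Set W, ZeroForcing.PathExtremal (H.induce s))
    {V : Type u} [Finite V] (G : SimpleGraph V)
    (hG : SplitDecomposition.InClassC H G) :
    ZeroForcing.PathExtremal G := by
  have := Fintype.ofFinite V
  obtain ⟨-, T, ⟨hT, hred⟩, r, -, huniq, ⟨e⟩⟩ := hG
  refine (T.extremalOn hind hT e (fun b hb => ?_) Finset.univ).pathExtremal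
  rcases hred.label_type b with h | h | h
  · exact .inl h
  · exact .inr h
  · exact absurd (huniq b h) hb
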